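/- Let $X$ be a random variable with values in $\mathbb N=\{0,1,2,\dots\}$ and finite variance, let $m=\mathrm E[X]$, let $X_1,X_2,\dots$ be i.i.d. copies of $X$, and fix $k\in\mathbb N$. For $x\in\mathbb R$ and $j\in\mathbb N$ put $f_j(x)=e^{-x}\left(1+x+\dots+\frac{x^j}{j!}\right)$, and for $n\ge 1$ let $$\overline X_n=\frac{X_1+\dots+X_n}{n},\qquad F_n(k)=\frac{I(X_1\le k)+\dots+I(X_n\le k)}{n},\qquad V_n^{(k)}=\sqrt n\,\bigl(f_k(\overline X_n)-F_n(k)\bigr).$$ (i) If $X$ has the Poisson distribution with parameter $\mu\ge 0$ (the case $\mu=0$ being the point mass at $0$), then $V_n^{(k)}$ converges in distribution, as $n\to\infty$, to $\mathcal N(0,\sigma^2_{\mu,k})$, where $$\sigma^2_{\mu,k}=\mathrm{Var}\left[e^{-\mu}\frac{\mu^k}{k!}X+I(X\le k)\right]=f_k(\mu)\bigl(1-f_k(\mu)\bigr)-\frac{e^{-2\mu}\mu^{2k+1}}{(k!)^2},$$ and $\mathcal N(0,0)$ denotes the point mass at $0$. (ii) If $P(X\le k)\ne f_k(m)$, then $|V_n^{(k)}|$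 converges in probability to $\infty$, that is, $P(|V_n^{(k)}|\le M)\to 0$ as $n\to\infty$ for every real $M$. (iii) There is some $j\in\mathbb N$ with $P(X\le j)\ne f_j(m)$ if and only if $X$ does not have a Poisson distribution (with any parameter $\mu\ge 0$). -/

import Mathlib

open MeasureTheory ProbabilityTheory Filter Topology
open scoped NNReal ENNReal

noncomputable section

/-- `poissonF k x = e^{-x} (1 + x + ... + x^k / k!)`, as a function of the real variable `x`. -/
def poissonF (k : ℕ) (x : ℝ) : ℝ :=
  Real.exp (-x) * ∑ j ∈ Finset.range (k + 1), x ^ j / (j.factorial : ℝ)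

/-- The sample mean of the first `n` observations `S 0, ..., S (n - 1)`. -/
def sampleMean {Ω : Type*} (S : ℕ → Ω → ℕ) (n : ℕ) (ω : Ω) : ℝ :=
  (∑ i ∈ Finset.range n, (S i ω : ℝ)) / (n : ℝ)

/-- The empirical cumulative distribution function of the first `n` observations, at `k`. -/
def empiricalCDF {Ω : Type*} (S : ℕ → Ω → ℕ) (n k : ℕ) (ω : Ω) : ℝ :=
  (∑ i ∈ Finset.range n, if S i ω ≤ k then (1 : ℝ) else 0) / (n : ℝ)

/-- The statistic `√n (f_k (sample mean) - F_n k)`. -/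
def statV {Ω : Type*} (S : ℕ → Ω → ℕ) (k n : ℕ) (ω : Ω) : ℝ :=
  Real.sqrt (n : ℝ) * (poissonF k (sampleMean S n ω) - empiricalCDF S n k ω)

/-- The closed form of the asymptotic variance,
`f_k(μ) (1 - f_k(μ)) - e^{-2μ} μ^{2k+1} / (k!)^2`. -/
def sigmaSq (μ : ℝ) (k : ℕ) : ℝ :=
  poissonF k μ * (1 - poissonF k μ)
    - Real.exp (-2 * μ) * μ ^ (2 * k + 1) / (k.factorial : ℝ) ^ 2

/-- Convergence in probability to `+∞`: for every level `M`, the probability of being at most `M`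
tends to zero. -/
def TendstoInProbabilityToInfinity {Ω : Type*} [MeasurableSpace Ω] (P : Measure Ω)
    (Y : ℕ → Ω → ℝ) : Prop :=
  ∀ M : ℝ, Tendsto (fun n => P {ω | Y n ω ≤ M}) atTop (𝓝 0)

end

/-!
The derivative of `f_k = poissonF k` is minus the Poisson weight `p_k(x) = e^{-x} x^k / k!`, whose own
derivative is bounded by `1` on `[0, ∞)`. Hence, with `m = E[X]`, the error of
`f_k(X̄ₙ) ≈ f_k(m) - p_k(m) (X̄ₙ - m)` is at most `(X̄ₙ - m)²`
(`abs_poissonF_taylor_le`), and `√n` times this error has `L¹` norm at most `Var[X] / √n`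
(`tendstoInMeasure_taylor_remainder`). When `P(X ≤ k) = f_k(m)`, what is left of the statistic is
the normalized centered sum of the i.i.d. variables `-(p_k(m) Xᵢ + I(Xᵢ ≤ k))`, to which
the central limit theorem and Slutsky's theorem apply (`tendstoInDistribution_statV`). For a Poisson
variable the limiting variance is computed from the Stein–Chen identity
`E[X g(X)] = μ E[g(X + 1)]` (`integral_natCast_mul_poissonMeasure`).

When `P(X ≤ k) ≠ f_k(m)`, the strong law of large numbers gives the statistic divided by `√n` a
nonzero limit, so the statistic itself diverges (`tendstoInProbabilityToInfinity_abs_statV`).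

Finally, a distribution function equal to `j ↦ f_j(m)` for all `j` has the Poisson weights as its
increments, which determine the law (`exists_hasLaw_poissonMeasure_iff`).
-/

/-! ### The Poisson weights and the derivative of the Poisson distribution function -/

/-- The Poisson probability `e^{-x} x^k / k!`, as a function of the real parameter `x`. -/
noncomputable def poissonWeight (k : ℕ) (x : ℝ) : ℝ :=
  Real.exp (-x) * (x ^ k / (k.factorial : ℝ))

lemma poissonF_zero (x : ℝ) : poissonF 0 x = poissonWeight 0 x := by
  simp [poissonF, poissonWeight]

lemma poissonF_succ (k : ℕ) (x : ℝ) :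
    poissonF (k + 1) x = poissonF k x + poissonWeight (k + 1) x := by
  rw [poissonF, Finset.sum_range_succ, mul_add]
  rfl

lemma hasDerivAt_poissonWeight_zero (x : ℝ) :
    HasDerivAt (poissonWeight 0) (-poissonWeight 0 x) x := by
  have h : poissonWeight 0 = fun y => Real.exp (-y) := by
    funext y
    simp [poissonWeight]
  rw [h]
  simpa using (hasDerivAt_neg x).exp

lemma hasDerivAt_poissonWeight_succ (k : ℕ) (x : ℝ) :
    HasDerivAt (poissonWeight (k + 1)) (poissonWeight k x - poissonWeight (k + 1) x) x := by
  have h := (hasDerivAt_neg x).exp.mul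
    ((hasDerivAt_pow (k + 1) x).div_const ((k + 1).factorial : ℝ))
  refine h.congr_deriv ?_
  have hk : (k.factorial : ℝ) ≠ 0 := by positivity
  simp only [poissonWeight, Nat.factorial_succ]
  push_cast
  field_simp
  ring

lemma hasDerivAt_poissonF (k : ℕ) (x : ℝ) :
    HasDerivAt (poissonF k) (-poissonWeight k x) x := by
  induction k with
  | zero =>
    rw [show poissonF 0 = poissonWeight 0 from funext poissonF_zero]
    exact hasDerivAt_poissonWeight_zero x
  | succ k ih =>
    rw [show poissonF (k + 1) = poissonF k + poissonWeight (k + 1) from funext (poissonF_succ k)]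
    exact (ih.add (hasDerivAt_poissonWeight_succ k x)).congr_deriv (by ring)

lemma continuous_poissonF (k : ℕ) : Continuous (poissonF k) := by
  unfold poissonF
  fun_prop

lemma poissonWeight_nonneg (k : ℕ) {x : ℝ} (hx : 0 ≤ x) : 0 ≤ poissonWeight k x := by
  unfold poissonWeight
  positivity

lemma poissonWeight_le_one (k : ℕ) {x : ℝ} (hx : 0 ≤ x) : poissonWeight k x ≤ 1 := by
  rw [poissonWeight, Real.exp_neg, inv_mul_le_one₀ (Real.exp_pos x)]
  exact Real.pow_div_factorial_le_exp x hx k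

lemma exists_hasDerivAt_poissonWeight_abs_le_one (k : ℕ) {x : ℝ} (hx : 0 ≤ x) :
    ∃ d, HasDerivAt (poissonWeight k) d x ∧ |d| ≤ 1 := by
  cases k with
  | zero =>
    refine ⟨_, hasDerivAt_poissonWeight_zero x, ?_⟩
    rw [abs_neg, abs_of_nonneg (poissonWeight_nonneg 0 hx)]
    exact poissonWeight_le_one 0 hx
  | succ k =>
    refine ⟨_, hasDerivAt_poissonWeight_succ k x, ?_⟩
    have h1 := poissonWeight_nonneg k hx
    have h2 := poissonWeight_le_one k hx
    have h3 := poissonWeight_nonneg (k + 1) hx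
    have h4 := poissonWeight_le_one (k + 1) hx
    exact abs_le.2 ⟨by linarith, by linarith⟩

lemma abs_poissonWeight_sub_le (k : ℕ) {x y : ℝ} (hx : 0 ≤ x) (hy : 0 ≤ y) :
    |poissonWeight k y - poissonWeight k x| ≤ |y - x| := by
  have hd : ∀ z ∈ Set.Ici (0 : ℝ), DifferentiableAt ℝ (poissonWeight k) z := fun z hz =>
    (exists_hasDerivAt_poissonWeight_abs_le_one k hz).choose_spec.1.differentiableAt
  have hb : ∀ z ∈ Set.Ici (0 : ℝ), ‖deriv (poissonWeight k) z‖ ≤ 1 := by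
    intro z hz
    obtain ⟨d, hd, hd1⟩ := exists_hasDerivAt_poissonWeight_abs_le_one k hz
    rwa [hd.deriv]
  simpa using (convex_Ici (0 : ℝ)).norm_image_sub_le_of_norm_deriv_le hd hb
    (Set.mem_Ici.2 hx) (Set.mem_Ici.2 hy)

/-- The remainder of the first-order Taylor expansion of `poissonF k` is at most quadratic,
uniformly on the half-line `[0, ∞)`, because the second derivative is bounded there. -/
lemma abs_poissonF_taylor_le (k : ℕ) {x y : ℝ} (hx : 0 ≤ x) (hy : 0 ≤ y) :
    |poissonF k y - poissonF k x + poissonWeight k x * (y - x)| ≤ (y - x) ^ 2 := by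
  have hder : ∀ z ∈ Set.uIcc x y, HasDerivWithinAt
      (fun z => poissonF k z + poissonWeight k x * z)
      (-poissonWeight k z + poissonWeight k x) (Set.uIcc x y) z := fun z _ =>
    ((hasDerivAt_poissonF k z).add
      ((hasDerivAt_id z).const_mul (poissonWeight k x))).hasDerivWithinAt.congr_deriv (by simp)
  have hbound : ∀ z ∈ Set.uIcc x y, ‖-poissonWeight k z + poissonWeight k x‖ ≤ |y - x| := by
    intro z hz
    have hz0 : 0 ≤ z := (le_inf hx hy).trans hz.1
    rw [Real.norm_eq_abs, neg_add_eq_sub]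
    refine (abs_poissonWeight_sub_le k hz0 hx).trans ?_
    rw [abs_sub_comm]
    exact Set.abs_sub_left_of_mem_uIcc hz
  have h := (convex_uIcc x y).norm_image_sub_le_of_norm_hasDerivWithin_le hder hbound
    Set.left_mem_uIcc Set.right_mem_uIcc
  rw [Real.norm_eq_abs, Real.norm_eq_abs, ← sq, sq_abs] at h
  convert h using 2
  ring

/-! ### Moments of the Poisson distribution -/

lemma poissonMeasure_real_singleton_eq_poissonWeight (μ : ℝ≥0) (n : ℕ) :
    (poissonMeasure μ).real {n} = poissonWeight n μ := by
  rw [poissonMeasure_real_singleton, poissonWeight, mul_div_assoc]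

lemma poissonMeasure_real_le_eq_poissonF (μ : ℝ≥0) (k : ℕ) :
    (poissonMeasure μ).real {n | n ≤ k} = poissonF k μ := by
  have h : {n : ℕ | n ≤ k} = (Finset.range (k + 1) : Finset ℕ) := by
    ext n
    simp
  rw [h, ← sum_measureReal_singleton, poissonF, Finset.mul_sum]
  exact Finset.sum_congr rfl fun n _ => poissonMeasure_real_singleton_eq_poissonWeight μ n

/-- The Stein–Chen identity `E[X g(X)] = μ E[g(X + 1)]` for a Poisson variable. No integrability
is needed: the two sums have the same nonzero terms. -/
lemma integral_natCast_mul_poissonMeasure (μ : ℝ≥0) (g : ℕ → ℝ) :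
    ∫ n, (n : ℝ) * g n ∂poissonMeasure μ = μ * ∫ n, g (n + 1) ∂poissonMeasure μ := by
  rw [integral_poissonMeasure, integral_poissonMeasure, ← tsum_mul_left,
    ← Nat.succ_injective.tsum_eq]
  · refine tsum_congr fun n => ?_
    have hn : (n.factorial : ℝ) ≠ 0 := by positivity
    simp only [Nat.succ_eq_add_one, Nat.factorial_succ, smul_eq_mul]
    push_cast
    field_simp
    ring
  · intro n hn
    cases n with
    | zero => simp at hn
    | succ n => exact ⟨n, rfl⟩

lemma integral_natCast_poissonMeasure (μ : ℝ≥0) :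
    ∫ n, (n : ℝ) ∂poissonMeasure μ = μ := by
  simpa using integral_natCast_mul_poissonMeasure μ fun _ => 1

lemma integral_ite_le (ν : Measure ℕ) (k : ℕ) :
    ∫ n, (if n ≤ k then (1 : ℝ) else 0) ∂ν = ν.real {n | n ≤ k} := by
  rw [← integral_indicator_one MeasurableSet.of_discrete]
  exact integral_congr_ae (.of_forall fun n => by simp [Set.indicator_apply])

lemma integral_ite_le_poissonMeasure (μ : ℝ≥0) (k : ℕ) :
    ∫ n, (if n ≤ k then (1 : ℝ) else 0) ∂poissonMeasure μ = poissonF k μ := by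
  rw [integral_ite_le, poissonMeasure_real_le_eq_poissonF]

lemma integral_natCast_mul_ite_le_poissonMeasure (μ : ℝ≥0) (k : ℕ) :
    ∫ n, (n : ℝ) * (if n ≤ k then (1 : ℝ) else 0) ∂poissonMeasure μ
      = μ * (poissonF k μ - poissonWeight k μ) := by
  rw [integral_natCast_mul_poissonMeasure]
  congr 1
  cases k with
  | zero => simp [poissonF_zero]
  | succ k => simp [integral_ite_le_poissonMeasure, poissonF_succ]

lemma memLp_ite_le {α : Type*} [MeasurableSpace α] {ν : Measure α} [IsFiniteMeasure ν]
    {Y : α → ℕ} (hY : AEMeasurable Y ν) (k : ℕ) :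
    MemLp (fun a => if Y a ≤ k then (1 : ℝ) else 0) 2 ν := by
  have hm : Measurable (fun n : ℕ => if n ≤ k then (1 : ℝ) else 0) := .of_discrete
  refine MemLp.of_bound (hm.comp_aemeasurable hY).aestronglyMeasurable 1
    (.of_forall fun a => ?_)
  split_ifs <;> simp

lemma sigmaSq_eq (μ : ℝ) (k : ℕ) :
    sigmaSq μ k = poissonF k μ * (1 - poissonF k μ) - μ * poissonWeight k μ ^ 2 := by
  rw [sigmaSq, poissonWeight, mul_pow, ← Real.exp_nat_mul, div_pow]
  push_cast
  ring_nf

/-- Both `Var[X] = μ` and `Cov(X, I(X ≤ k)) = -μ · poissonWeight k μ` come from the Stein–Chen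
identity. -/
lemma variance_poissonMeasure_linear (μ : ℝ≥0) (k : ℕ)
    (hint : MemLp (fun n : ℕ => (n : ℝ)) 2 (poissonMeasure μ)) :
    variance (fun n : ℕ => poissonWeight k μ * (n : ℝ) + (if n ≤ k then (1 : ℝ) else 0))
      (poissonMeasure μ) = sigmaSq μ k := by
  have hI : MemLp (fun n : ℕ => if n ≤ k then (1 : ℝ) else 0) 2 (poissonMeasure μ) :=
    memLp_ite_le aemeasurable_id k
  have hi1 : Integrable (fun n : ℕ => (n : ℝ)) (poissonMeasure μ) := hint.integrable (by norm_num)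
  have hvX : variance (fun n : ℕ => (n : ℝ)) (poissonMeasure μ) = μ := by
    have h2 : ∫ n, (n : ℝ) ^ 2 ∂poissonMeasure μ = μ * (μ + 1) := by
      simp_rw [sq]
      rw [integral_natCast_mul_poissonMeasure μ fun n => (n : ℝ)]
      push_cast
      rw [integral_add hi1 (integrable_const _), integral_natCast_poissonMeasure]
      simp
    rw [variance_eq_sub hint]
    simp only [Pi.pow_apply, h2, integral_natCast_poissonMeasure]
    ring
  have hvI : variance (fun n : ℕ => if n ≤ k then (1 : ℝ) else 0) (poissonMeasure μ)
      = poissonF k μ * (1 - poissonF k μ) := by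
    rw [variance_eq_sub hI]
    simp only [Pi.pow_apply, ite_pow, one_pow, ne_eq, OfNat.ofNat_ne_zero, not_false_eq_true,
      zero_pow, integral_ite_le_poissonMeasure]
    ring
  have hcov : covariance (fun n : ℕ => (n : ℝ)) (fun n : ℕ => if n ≤ k then (1 : ℝ) else 0)
      (poissonMeasure μ) = -(μ * poissonWeight k μ) := by
    rw [covariance_eq_sub hint hI]
    simp only [Pi.mul_apply, integral_natCast_mul_ite_le_poissonMeasure,
      integral_natCast_poissonMeasure, integral_ite_le_poissonMeasure]
    ring
  rw [variance_fun_add (hint.const_mul _) hI, variance_const_mul, covariance_const_mul_left, hvX,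
    hvI, hcov, sigmaSq_eq]
  ring

lemma variance_linear_of_hasLaw_poissonMeasure {Ω₀ : Type*} [MeasurableSpace Ω₀] {P₀ : Measure Ω₀}
    {X : Ω₀ → ℕ} (hX : MemLp (fun ω => (X ω : ℝ)) 2 P₀) {μ : ℝ≥0}
    (hμ : HasLaw X (poissonMeasure μ) P₀) (k : ℕ) :
    variance (fun ω => poissonWeight k μ * (X ω : ℝ) + (if X ω ≤ k then (1 : ℝ) else 0)) P₀
      = sigmaSq μ k := by
  have hint : MemLp (fun n : ℕ => (n : ℝ)) 2 (poissonMeasure μ) := by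
    rw [← hμ.map_eq]
    exact (memLp_map_measure_iff Measurable.of_discrete.aestronglyMeasurable hμ.aemeasurable).2 hX
  rw [← variance_poissonMeasure_linear μ k hint, ← hμ.map_eq,
    variance_map Measurable.of_discrete.aemeasurable hμ.aemeasurable]
  rfl

lemma integral_of_hasLaw_poissonMeasure {Ω₀ : Type*} [MeasurableSpace Ω₀] {P₀ : Measure Ω₀}
    {X : Ω₀ → ℕ} {μ : ℝ≥0} (hμ : HasLaw X (poissonMeasure μ) P₀) (g : ℕ → ℝ) :
    ∫ ω, g (X ω) ∂P₀ = ∫ n, g n ∂poissonMeasure μ :=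
  hμ.integral_comp Measurable.of_discrete.aestronglyMeasurable

/-! ### Characterization of the Poisson distribution -/

/-- A Poisson variable has distribution function `j ↦ poissonF j (E[X])`, and conversely the
increments of this distribution function are the Poisson weights. -/
lemma exists_hasLaw_poissonMeasure_iff {Ω₀ : Type*} [MeasurableSpace Ω₀] {P₀ : Measure Ω₀}
    [IsProbabilityMeasure P₀] {X : Ω₀ → ℕ} (hX : AEMeasurable X P₀) :
    (∃ μ : ℝ≥0, HasLaw X (poissonMeasure μ) P₀) ↔
      ∀ j : ℕ, P₀.real {ω | X ω ≤ j} = poissonF j (∫ ω, (X ω : ℝ) ∂P₀) := by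
  constructor
  · rintro ⟨μ, hμ⟩ j
    rw [integral_of_hasLaw_poissonMeasure hμ fun n => (n : ℝ), integral_natCast_poissonMeasure,
      ← poissonMeasure_real_le_eq_poissonF]
    exact hμ.measureReal_eq (p := fun n => n ≤ j) MeasurableSet.of_discrete
  · intro h
    have h0 : 0 ≤ ∫ ω, (X ω : ℝ) ∂P₀ := integral_nonneg fun ω => Nat.cast_nonneg _
    lift ∫ ω, (X ω : ℝ) ∂P₀ to ℝ≥0 using h0 with μ
    have : IsProbabilityMeasure (P₀.map X) := Measure.isProbabilityMeasure_map hX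
    have hcdf : ∀ j : ℕ, (P₀.map X).real {n | n ≤ j} = poissonF j μ := fun j => by
      rw [map_measureReal_apply_of_aemeasurable hX MeasurableSet.of_discrete]
      exact h j
    refine ⟨μ, hX, Measure.ext_of_singleton fun n => ?_⟩
    rw [← measureReal_eq_measureReal_iff, poissonMeasure_real_singleton_eq_poissonWeight]
    cases n with
    | zero =>
      rw [← poissonF_zero, ← hcdf 0]
      congr
      ext n
      simp
    | succ n =>
      have hsplit : {m : ℕ | m ≤ n + 1} = {m | m ≤ n} ∪ {n + 1} := by
        ext m
        simp
        omega
      have hu := hcdf (n + 1)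
      rw [hsplit, measureReal_union (by simp) MeasurableSet.of_discrete, hcdf n,
        poissonF_succ] at hu
      linarith

/-! ### Empirical averages of independent copies -/

section Averages

variable {Ω₀ Ω : Type*} [MeasurableSpace Ω₀] [MeasurableSpace Ω] {P₀ : Measure Ω₀}
  {P : Measure Ω} {X : Ω₀ → ℕ} {S : ℕ → Ω → ℕ}

lemma iIndepFun_comp_nat (hindep : iIndepFun S P) (g : ℕ → ℝ) :
    iIndepFun (fun i ω => g (S i ω)) P :=
  hindep.comp (fun _ => g) fun _ => .of_discrete

lemma identDistrib_comp_nat (hident : ∀ i, IdentDistrib (S i) X P P₀) (g : ℕ → ℝ) (i : ℕ) :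
    IdentDistrib (fun ω => g (S i ω)) (fun ω => g (X ω)) P P₀ :=
  (hident i).comp .of_discrete

lemma identDistrib_comp_nat_zero (hident : ∀ i, IdentDistrib (S i) X P P₀) (g : ℕ → ℝ) (i : ℕ) :
    IdentDistrib (fun ω => g (S i ω)) (fun ω => g (S 0 ω)) P P :=
  (identDistrib_comp_nat hident g i).trans (identDistrib_comp_nat hident g 0).symm

lemma aemeasurable_average (hident : ∀ i, IdentDistrib (S i) X P P₀) (g : ℕ → ℝ) (n : ℕ) :
    AEMeasurable (fun ω => (∑ i ∈ Finset.range n, g (S i ω)) / (n : ℝ)) P :=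
  (Finset.aemeasurable_fun_sum _ fun i _ =>
    (identDistrib_comp_nat hident g i).aemeasurable_fst).div_const _

lemma aemeasurable_sampleMean (hident : ∀ i, IdentDistrib (S i) X P P₀) (n : ℕ) :
    AEMeasurable (sampleMean S n) P :=
  aemeasurable_average hident (fun m => (m : ℝ)) n

lemma aemeasurable_poissonF_sub_empiricalCDF (hident : ∀ i, IdentDistrib (S i) X P P₀)
    (k n : ℕ) :
    AEMeasurable (fun ω => poissonF k (sampleMean S n ω) - empiricalCDF S n k ω) P :=
  ((continuous_poissonF k).measurable.comp_aemeasurable (aemeasurable_sampleMean hident n)).sub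
    (aemeasurable_average hident (fun m => if m ≤ k then (1 : ℝ) else 0) n)

lemma aemeasurable_statV (hident : ∀ i, IdentDistrib (S i) X P P₀) (k n : ℕ) :
    AEMeasurable (statV S k n) P :=
  (aemeasurable_poissonF_sub_empiricalCDF hident k n).const_mul _

lemma ae_tendsto_average (hindep : iIndepFun S P) (hident : ∀ i, IdentDistrib (S i) X P P₀)
    {g : ℕ → ℝ} (hg : Integrable (fun ω => g (X ω)) P₀) :
    ∀ᵐ ω ∂P, Tendsto (fun n : ℕ => (∑ i ∈ Finset.range n, g (S i ω)) / (n : ℝ)) atTop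
      (𝓝 (∫ ω, g (X ω) ∂P₀)) := by
  rw [← (identDistrib_comp_nat hident g 0).integral_eq]
  exact strong_law_ae_real (fun i ω => g (S i ω))
    ((identDistrib_comp_nat hident g 0).symm.integrable_snd hg)
    (fun _ _ hij => (iIndepFun_comp_nat hindep g).indepFun hij)
    (identDistrib_comp_nat_zero hident g)

lemma ae_tendsto_poissonF_sub_empiricalCDF [IsProbabilityMeasure P₀] (hindep : iIndepFun S P)
    (hident : ∀ i, IdentDistrib (S i) X P P₀) (hX : Integrable (fun ω => (X ω : ℝ)) P₀) (k : ℕ) :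
    ∀ᵐ ω ∂P, Tendsto (fun n => poissonF k (sampleMean S n ω) - empiricalCDF S n k ω) atTop
      (𝓝 (poissonF k (∫ ω, (X ω : ℝ) ∂P₀) - P₀.real {ω | X ω ≤ k})) := by
  have hXm : AEMeasurable X P₀ := (hident 0).aemeasurable_snd
  have hprob : ∫ ω, (if X ω ≤ k then (1 : ℝ) else 0) ∂P₀ = P₀.real {ω | X ω ≤ k} := by
    rw [← integral_map (f := fun n : ℕ => if n ≤ k then (1 : ℝ) else 0) hXm
      Measurable.of_discrete.aestronglyMeasurable, integral_ite_le,
      map_measureReal_apply_of_aemeasurable hXm MeasurableSet.of_discrete]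
    rfl
  filter_upwards [ae_tendsto_average hindep hident (g := fun n => (n : ℝ)) hX,
    ae_tendsto_average hindep hident (g := fun n => if n ≤ k then (1 : ℝ) else 0)
      ((memLp_ite_le hXm k).integrable (by norm_num))] with ω h1 h2
  rw [← hprob]
  exact (((continuous_poissonF k).tendsto _).comp h1).sub h2

/-- The mean squared error of the sample mean is `Var[X] / n`. -/
lemma integral_sampleMean_sub_sq [IsProbabilityMeasure P] (hindep : iIndepFun S P)
    (hident : ∀ i, IdentDistrib (S i) X P P₀) (hX : MemLp (fun ω => (X ω : ℝ)) 2 P₀) {n : ℕ}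
    (hn : n ≠ 0) :
    Integrable (fun ω => (sampleMean S n ω - ∫ ω, (X ω : ℝ) ∂P₀) ^ 2) P ∧
    ∫ ω, (sampleMean S n ω - ∫ ω, (X ω : ℝ) ∂P₀) ^ 2 ∂P
      = variance (fun ω => (X ω : ℝ)) P₀ / n := by
  have hid := identDistrib_comp_nat hident (fun m => (m : ℝ))
  have hLp : ∀ i, MemLp (fun ω => (S i ω : ℝ)) 2 P := fun i => (hid i).symm.memLp_snd hX
  have hn' : (n : ℝ) ≠ 0 := by exact_mod_cast hn
  have hsm : sampleMean S n =
      fun ω => (n : ℝ)⁻¹ * (∑ i ∈ Finset.range n, fun ω => (S i ω : ℝ)) ω := by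
    funext ω
    simp [sampleMean, div_eq_inv_mul]
  have hmemLp : MemLp (sampleMean S n) 2 P := by
    rw [hsm]
    exact (memLp_finsetSum' _ fun i _ => hLp i).const_mul _
  have hmean : ∫ ω, sampleMean S n ω ∂P = ∫ ω, (X ω : ℝ) ∂P₀ := by
    simp_rw [sampleMean]
    rw [integral_div, integral_finsetSum _ fun i _ => (hLp i).integrable (by norm_num)]
    simp_rw [fun i => (hid i).integral_eq]
    simp [hn']
  refine ⟨(hmemLp.sub (memLp_const _)).integrable_sq, ?_⟩
  rw [← hmean, ← variance_eq_integral hmemLp.aestronglyMeasurable.aemeasurable, hsm,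
    variance_const_mul, IndepFun.variance_sum (fun i _ => hLp i) fun i _ j _ hij =>
      (iIndepFun_comp_nat hindep (fun m => (m : ℝ))).indepFun hij]
  simp_rw [fun i => (hid i).variance_eq]
  simp
  field_simp

/-! ### Asymptotic behaviour of the statistic -/

/-- If `P(X ≤ k)` differs from `poissonF k (E[X])`, the unscaled difference has a nonzero limit in
probability, so that the factor `√n` drives the statistic to infinity. -/
lemma tendstoInProbabilityToInfinity_abs_statV [IsProbabilityMeasure P₀] [IsProbabilityMeasure P]
    (hindep : iIndepFun S P) (hident : ∀ i, IdentDistrib (S i) X P P₀)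
    (hX : Integrable (fun ω => (X ω : ℝ)) P₀) (k : ℕ)
    (hne : P₀.real {ω | X ω ≤ k} ≠ poissonF k (∫ ω, (X ω : ℝ) ∂P₀)) :
    TendstoInProbabilityToInfinity P (fun n ω => |statV S k n ω|) := by
  intro M
  set c := poissonF k (∫ ω, (X ω : ℝ) ∂P₀) - P₀.real {ω | X ω ≤ k} with hc
  have hc0 : 0 < |c| := abs_pos.2 (sub_ne_zero.2 hne.symm)
  have hmeas := tendstoInMeasure_of_tendsto_ae
    (fun n => (aemeasurable_poissonF_sub_empiricalCDF hident k n).aestronglyMeasurable)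
    (ae_tendsto_poissonF_sub_empiricalCDF hindep hident hX k)
  rw [tendstoInMeasure_iff_norm] at hmeas
  refine tendsto_of_tendsto_of_tendsto_of_le_of_le' tendsto_const_nhds
    (hmeas (|c| / 2) (by positivity)) (.of_forall fun _ => zero_le) ?_
  have hsqrt : Tendsto (fun n : ℕ => Real.sqrt n * (|c| / 2)) atTop atTop :=
    (Real.tendsto_sqrt_atTop.comp tendsto_natCast_atTop_atTop).atTop_mul_const (by positivity)
  filter_upwards [hsqrt.eventually_gt_atTop M] with n hn
  refine measure_mono fun ω hω => ?_
  simp only [Set.mem_ofPred_eq, Real.norm_eq_abs] at hω ⊢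
  rw [statV, abs_mul, abs_of_nonneg (Real.sqrt_nonneg _)] at hω
  by_contra! hlt
  have h1 : |c| / 2 ≤ |poissonF k (sampleMean S n ω) - empiricalCDF S n k ω| := by
    have := abs_sub_abs_le_abs_sub c (poissonF k (sampleMean S n ω) - empiricalCDF S n k ω)
    rw [abs_sub_comm c] at this
    linarith
  have := mul_le_mul_of_nonneg_left h1 (Real.sqrt_nonneg (n : ℝ))
  linarith

/-- The delta-method remainder `√n (f_k(X̄ₙ) - f_k(m) + p_k(m) (X̄ₙ - m))` tends to `0` in
probability: by the quadratic Taylor bound its `L¹` norm is at most `Var[X] / √n`. -/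
lemma tendstoInMeasure_taylor_remainder [IsProbabilityMeasure P] (hindep : iIndepFun S P)
    (hident : ∀ i, IdentDistrib (S i) X P P₀) (hX : MemLp (fun ω => (X ω : ℝ)) 2 P₀) (k : ℕ) :
    TendstoInMeasure P (fun (n : ℕ) ω => Real.sqrt n *
        (poissonF k (sampleMean S n ω) - poissonF k (∫ ω, (X ω : ℝ) ∂P₀)
          + poissonWeight k (∫ ω, (X ω : ℝ) ∂P₀) * (sampleMean S n ω - ∫ ω, (X ω : ℝ) ∂P₀)))
      atTop 0 := by
  have hm : 0 ≤ ∫ ω, (X ω : ℝ) ∂P₀ := integral_nonneg fun ω => Nat.cast_nonneg _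
  set m := ∫ ω, (X ω : ℝ) ∂P₀ with hmdef
  have hsm0 : ∀ n ω, 0 ≤ sampleMean S n ω := fun n ω => by
    unfold sampleMean
    positivity
  have hae : ∀ n : ℕ, AEStronglyMeasurable (fun ω => Real.sqrt n *
      (poissonF k (sampleMean S n ω) - poissonF k m
        + poissonWeight k m * (sampleMean S n ω - m))) P := by
    intro n
    have h1 := aemeasurable_sampleMean hident n
    have h2 := (continuous_poissonF k).measurable.comp_aemeasurable h1
    exact (((h2.sub_const _).add ((h1.sub_const _).const_mul _)).const_mul _).aestronglyMeasurable
  refine tendstoInMeasure_of_tendsto_eLpNorm one_ne_zero hae aestronglyMeasurable_zero ?_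
  simp only [sub_zero]
  have hlim : Tendsto (fun n : ℕ => ENNReal.ofReal
      (variance (fun ω => (X ω : ℝ)) P₀ / Real.sqrt n)) atTop (𝓝 0) := by
    rw [← ENNReal.ofReal_zero]
    exact ENNReal.tendsto_ofReal
      ((Real.tendsto_sqrt_atTop.comp tendsto_natCast_atTop_atTop).const_div_atTop _)
  refine tendsto_of_tendsto_of_tendsto_of_le_of_le' tendsto_const_nhds hlim
    (.of_forall fun _ => zero_le) ?_
  filter_upwards [eventually_ne_atTop 0] with n hn
  obtain ⟨hint, hval⟩ := integral_sampleMean_sub_sq hindep hident hX hn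
  calc eLpNorm _ 1 P
      ≤ eLpNorm (fun ω => Real.sqrt n * (sampleMean S n ω - m) ^ 2) 1 P := by
        refine eLpNorm_mono_real fun ω => ?_
        rw [Real.norm_eq_abs, abs_mul, abs_of_nonneg (Real.sqrt_nonneg _)]
        exact mul_le_mul_of_nonneg_left (abs_poissonF_taylor_le k hm (hsm0 n ω))
          (Real.sqrt_nonneg _)
    _ = ENNReal.ofReal (∫ ω, Real.sqrt n * (sampleMean S n ω - m) ^ 2 ∂P) := by
        rw [eLpNorm_one_eq_lintegral_enorm,
          ofReal_integral_eq_lintegral_ofReal (hint.const_mul _)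
            (.of_forall fun ω => mul_nonneg (Real.sqrt_nonneg _) (sq_nonneg _))]
        exact lintegral_congr fun ω => Real.enorm_of_nonneg
          (mul_nonneg (Real.sqrt_nonneg _) (sq_nonneg _))
    _ = ENNReal.ofReal (variance (fun ω => (X ω : ℝ)) P₀ / Real.sqrt n) := by
        rw [integral_const_mul, hval]
        congr 1
        have hn' : (0 : ℝ) < n := by positivity
        have hs : Real.sqrt n ≠ 0 := (Real.sqrt_pos.2 hn').ne'
        field_simp
        rw [Real.sq_sqrt hn'.le, mul_comm]

/-- The delta method: when `P(X ≤ k) = poissonF k (E[X])`, the statistic is asymptotically a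
normalized centered sum of the i.i.d. variables `-(p_k(m) Xᵢ + I(Xᵢ ≤ k))`, where `p_k` is
`poissonWeight k` and `m = E[X]`. -/
lemma tendstoInDistribution_statV [IsProbabilityMeasure P₀] [IsProbabilityMeasure P]
    (hindep : iIndepFun S P) (hident : ∀ i, IdentDistrib (S i) X P P₀)
    (hX : MemLp (fun ω => (X ω : ℝ)) 2 P₀) (k : ℕ)
    (hcdf : ∫ ω, (if X ω ≤ k then (1 : ℝ) else 0) ∂P₀ = poissonF k (∫ ω, (X ω : ℝ) ∂P₀)) :
    TendstoInDistribution (fun n => statV S k n) atTop (id : ℝ → ℝ) (fun _ => P)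
      (gaussianReal 0 (Real.toNNReal (variance (fun ω =>
        poissonWeight k (∫ ω, (X ω : ℝ) ∂P₀) * (X ω : ℝ)
          + (if X ω ≤ k then (1 : ℝ) else 0)) P₀))) := by
  set m := ∫ ω, (X ω : ℝ) ∂P₀ with hm
  set g : ℕ → ℝ := fun n => -(poissonWeight k m * (n : ℝ) + (if n ≤ k then (1 : ℝ) else 0)) with hg
  have hI := memLp_ite_le (hident 0).aemeasurable_snd k
  have hgLp : MemLp (fun ω => g (X ω)) 2 P₀ := ((hX.const_mul _).add hI).neg
  have hid := identDistrib_comp_nat hident g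
  have hmean : ∫ ω, g (S 0 ω) ∂P = -(poissonWeight k m * m + poissonF k m) := by
    rw [(hid 0).integral_eq]
    simp only [hg]
    rw [integral_neg, integral_add ((hX.integrable (by norm_num)).const_mul _)
      (hI.integrable (by norm_num)), integral_const_mul, hcdf]
  have hvar : variance (fun ω => g (S 0 ω)) P = variance (fun ω =>
      poissonWeight k m * (X ω : ℝ) + (if X ω ≤ k then (1 : ℝ) else 0)) P₀ := by
    rw [(hid 0).variance_eq]
    exact variance_fun_neg
  have hclt := tendstoInDistribution_inv_sqrt_mul_sum_sub (X := fun i ω => g (S i ω))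
    (Y := (id : ℝ → ℝ))
    (P' := gaussianReal 0 (Real.toNNReal (variance (fun ω => g (S 0 ω)) P)))
    ⟨aemeasurable_id, Measure.map_id⟩ ((hid 0).symm.memLp_snd hgLp) (iIndepFun_comp_nat hindep g)
    (identDistrib_comp_nat_zero hident g)
  rw [← hvar]
  refine tendstoInDistribution_of_tendstoInMeasure_sub _ _ hclt ?_
    (fun n => aemeasurable_statV hident k n)
  refine (tendstoInMeasure_taylor_remainder hindep hident hX k).congr_left fun n =>
    .of_forall fun ω => ?_
  simp only [Pi.sub_apply, hmean, ← hm, statV]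
  -- For `n = 0` both averages have the junk value `0 / 0`, but the factor `√0` kills them.
  rcases Nat.eq_zero_or_pos n with rfl | hn
  · simp
  · have hn' : (0 : ℝ) < n := by positivity
    have hs : Real.sqrt n ≠ 0 := (Real.sqrt_pos.2 hn').ne'
    have hsum : ∑ i ∈ Finset.range n, g (S i ω)
        = -(n * (poissonWeight k m * sampleMean S n ω + empiricalCDF S n k ω)) := by
      simp only [hg, Finset.sum_neg_distrib, Finset.sum_add_distrib, ← Finset.mul_sum, sampleMean,
        empiricalCDF]
      field_simp
    have hinv : (Real.sqrt n)⁻¹ * (n : ℝ) = Real.sqrt n := by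
      rw [inv_mul_eq_div, Real.div_sqrt]
    rw [hsum]
    linear_combination (-(poissonWeight k m * sampleMean S n ω + empiricalCDF S n k ω)
      + (poissonWeight k m * m + poissonF k m)) * hinv

end Averages

theorem proposition2 {Ω₀ Ω : Type*} [MeasurableSpace Ω₀] [MeasurableSpace Ω]
    (P₀ : Measure Ω₀) [IsProbabilityMeasure P₀] (P : Measure Ω) [IsProbabilityMeasure P]
    (X : Ω₀ → ℕ) (hX : MemLp (fun ω => (X ω : ℝ)) 2 P₀)
    (S : ℕ → Ω → ℕ) (hindep : iIndepFun S P) (hident : ∀ i, IdentDistrib (S i) X P P₀)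
    (k : ℕ) :
    (∀ μ : ℝ≥0, HasLaw X (poissonMeasure μ) P₀ →
      variance (fun ω => Real.exp (-(μ : ℝ)) * ((μ : ℝ) ^ k / (k.factorial : ℝ)) * (X ω : ℝ)
          + (if X ω ≤ k then (1 : ℝ) else 0)) P₀ = sigmaSq μ k ∧
      TendstoInDistribution (fun n => statV S k n) atTop (id : ℝ → ℝ) (fun _ => P)
        (gaussianReal 0 (Real.toNNReal (sigmaSq μ k)))) ∧
    (P₀.real {ω | X ω ≤ k} ≠ poissonF k (∫ ω, (X ω : ℝ) ∂P₀) →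
      TendstoInProbabilityToInfinity P (fun n ω => |statV S k n ω|)) ∧
    ((∃ j : ℕ, P₀.real {ω | X ω ≤ j} ≠ poissonF j (∫ ω, (X ω : ℝ) ∂P₀)) ↔
      ∀ μ : ℝ≥0, ¬ HasLaw X (poissonMeasure μ) P₀) := by
  have hXm : AEMeasurable X P₀ := (hident 0).aemeasurable_snd
  refine ⟨fun μ hμ => ?_, tendstoInProbabilityToInfinity_abs_statV hindep hident
    (hX.integrable (by norm_num)) k, ?_⟩
  · have hvar := variance_linear_of_hasLaw_poissonMeasure hX hμ k
    have hmean : ∫ ω, (X ω : ℝ) ∂P₀ = μ := by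
      rw [integral_of_hasLaw_poissonMeasure hμ fun n => (n : ℝ), integral_natCast_poissonMeasure]
    have hcdf : ∫ ω, (if X ω ≤ k then (1 : ℝ) else 0) ∂P₀ = poissonF k (∫ ω, (X ω : ℝ) ∂P₀) := by
      rw [hmean, integral_of_hasLaw_poissonMeasure hμ fun n => if n ≤ k then (1 : ℝ) else 0,
        integral_ite_le_poissonMeasure]
    have hlim := tendstoInDistribution_statV hindep hident hX k hcdf
    rw [hmean] at hlim
    exact ⟨hvar, hvar ▸ hlim⟩
  · rw [← not_exists, exists_hasLaw_poissonMeasure_iff hXm, not_forall]
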